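/- Let $H$ be a separable infinite-dimensional complex Hilbert space. Let $\mathrm{SA}(H)$ be the set of all (possibly unbounded) self-adjoint operators on $H$. The norm resolvent topology (NRT) on $\mathrm{SA}(H)$ is the weakest topology for which $A\mapsto (A-i)^{-1}\in\mathbb{B}(H)$ is continuous with respect to the operator norm. The essential spectrum $\sigma_{\mathrm{ess}}(A)$ of $A\in\mathrm{SA}(H)$ is the set of all $\lambda\in\sigma(A)$ that are eigenvalues of infinite multiplicity or accumulation points of $\sigma(A)$. Put $$\mathrm{EES}(H)=\{A\in\mathrm{SA}(H)\,;\ \sigma_{\mathrm{ess}}(A)=\emptyset\},$$ with the subspace topology of the NRT. Let $\mathbb{K}(H)_{\mathrm{sa}}$ be the additive group of compact self-adjoint operators on $H$ with the norm topology, $\mathcal{U}(H)$ the unitary group of $H$ with the strong operator topology, and $G=\mathbb{K}(H)_{\mathrm{sa}}\rtimes\mathcal{U}(H)$ the semidirect product, with multiplication $(K_1,u_1)(K_2,u_2)=(K_1+u_1K_2u_1^*,\,u_1u_2)$ and the product topology. The group $G$ acts on $\mathrm{SA}(H)$ by $(K,u)\cdot A=uAu^*+K$. **Proposition.** $\mathrm{EES}(H)$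 with the norm resolvent topology is a Polish $G$-space for the restricted action. That is: $G$ is a Polish group; $\mathrm{EES}(H)$ is a Polish space; $\mathrm{EES}(H)$ is invariant under the action of $G$ on $\mathrm{SA}(H)$; and the restricted action $G\times\mathrm{EES}(H)\to\mathrm{EES}(H)$ is (jointly) continuous. -/

import Mathlib

open scoped InnerProductSpace

noncomputable section

namespace EESPolish

variable {H : Type*} [NormedAddCommGroup H] [InnerProductSpace ℂ H]

/-! ### The unitary group -/

variable (H) in
/-- The unitary group `U(H)`: surjective linear isometries of `H`, so that `u* = u⁻¹ = u.symm`. -/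
abbrev U : Type _ := H ≃ₗᵢ[ℂ] H

/-- A unitary as a bounded operator. -/
def U.toCLM (u : U H) : H →L[ℂ] H := (u.toContinuousLinearEquiv : H →L[ℂ] H)

/-- The strong operator topology on `U(H)`, the topology of pointwise convergence. -/
instance U.strongOperatorTopology : TopologicalSpace (U H) :=
  TopologicalSpace.induced (fun (u : U H) (x : H) => u x) inferInstance

theorem U.apply_inv (u : U H) (x : H) : u (u⁻¹ x) = x :=
  LinearIsometryEquiv.apply_symm_apply u x

theorem U.inv_apply (u : U H) (x : H) : u⁻¹ (u x) = x :=
  LinearIsometryEquiv.symm_apply_apply u x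

theorem U.inner_apply (u : U H) (x y : H) : ⟪u x, u y⟫_ℂ = ⟪x, y⟫_ℂ :=
  LinearIsometryEquiv.inner_map_map u x y

theorem U.inner_apply_left (u : U H) (x y : H) : ⟪u x, y⟫_ℂ = ⟪x, u⁻¹ y⟫_ℂ := by
  rw [← u.inner_apply x, u.apply_inv]

theorem U.inner_inv_apply_left (u : U H) (x y : H) : ⟪u⁻¹ x, y⟫_ℂ = ⟪x, u y⟫_ℂ := by
  rw [← u.inner_apply (u⁻¹ x), u.apply_inv]

/-- The operator `u K u*`. -/
def U.conjCLM (u : U H) (K : H →L[ℂ] H) : H →L[ℂ] H := u.toCLM * K * (u⁻¹).toCLM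

variable [CompleteSpace H]

/-! ### Resolvents and the essential spectrum of an unbounded operator -/

/-- `R` is a bounded, everywhere defined two-sided inverse of `A - z`. -/
def IsResolventAt (A : H →ₗ.[ℂ] H) (z : ℂ) (R : H →L[ℂ] H) : Prop :=
  (∀ y : H, ∃ h : R y ∈ A.domain, A ⟨R y, h⟩ - z • R y = y) ∧
    ∀ x : A.domain, R (A x - z • (x : H)) = x

/-- The spectrum `σ(A)`: those `z` for which `A - z` has no bounded inverse. -/
def opSpectrum (A : H →ₗ.[ℂ] H) : Set ℂ :=
  {z | ¬ ∃ R : H →L[ℂ] H, IsResolventAt A z R}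

/-- The eigenspace `{x ∈ dom A : A x = z x}`. -/
def opEigenspace (A : H →ₗ.[ℂ] H) (z : ℂ) : Submodule ℂ A.domain :=
  LinearMap.ker (A.toFun - z • A.domain.subtype)

/-- The essential spectrum `σ_ess(A)`: the points of the spectrum which are eigenvalues of
infinite multiplicity or accumulation points of the spectrum. -/
def essSpectrum (A : H →ₗ.[ℂ] H) : Set ℂ :=
  {z | z ∈ opSpectrum A ∧
    (¬ FiniteDimensional ℂ (opEigenspace A z) ∨ AccPt z (Filter.principal (opSpectrum A)))}

/-! ### Self-adjoint operators -/

variable (H) in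
/-- The set `SA(H)` of all (possibly unbounded) self-adjoint operators on `H`.
Mathlib's `IsSelfAdjoint` for `LinearPMap` implies that the domain is dense. -/
@[ext] structure SA where
  /-- the underlying partially defined operator -/
  op : H →ₗ.[ℂ] H
  isSelfAdjoint : IsSelfAdjoint op

theorem isSelfAdjoint_iff_graph (A : H →ₗ.[ℂ] H) :
    IsSelfAdjoint A ↔ Dense (A.domain : Set H) ∧
      ∀ x y : H, (x, y) ∈ A.graph ↔ ∀ a : A.domain, ⟪A a, x⟫_ℂ = ⟪(a : H), y⟫_ℂ := by
  have key : ∀ x y : H, (x, y) ∈ A.graph.adjoint ↔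
      ∀ a : A.domain, ⟪A a, x⟫_ℂ = ⟪(a : H), y⟫_ℂ := by
    intro x y
    rw [Submodule.mem_adjoint_iff]
    constructor
    · intro h a
      exact sub_eq_zero.1 (h a (A a) (A.mem_graph a))
    · intro h a b hab
      obtain ⟨a', rfl, rfl⟩ := (LinearPMap.mem_graph_iff A).1 hab
      exact sub_eq_zero.2 (h a')
  constructor
  · intro hA
    refine ⟨hA.dense_domain, fun x y => ?_⟩
    rw [← key, ← LinearPMap.adjoint_graph_eq_graph_adjoint hA.dense_domain,
      LinearPMap.isSelfAdjoint_def.1 hA]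
  · rintro ⟨hd, h⟩
    rw [LinearPMap.isSelfAdjoint_def]
    apply LinearPMap.eq_of_eq_graph
    rw [LinearPMap.adjoint_graph_eq_graph_adjoint hd]
    ext ⟨x, y⟩
    rw [key, h]

theorem SA.exists_resolvent (A : SA H) : ∃ R : H →L[ℂ] H, IsResolventAt A.op Complex.I R := by
  have hA := A.isSelfAdjoint
  obtain ⟨hd, hg⟩ := (isSelfAdjoint_iff_graph A.op).1 hA
  have hsym : ∀ a b : A.op.domain, ⟪A.op a, (b : H)⟫_ℂ = ⟪(a : H), A.op b⟫_ℂ :=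
    fun a b => (hg b (A.op b)).1 (A.op.mem_graph b) a
  have hnorm : ∀ a : A.op.domain, ‖A.op a - Complex.I • (a : H)‖ ^ 2
      = ‖A.op a‖ ^ 2 + ‖(a : H)‖ ^ 2 := by
    intro a
    have him : (⟪A.op a, (a : H)⟫_ℂ).im = 0 := by
      have h1 := hsym a a
      rw [← inner_conj_symm (a : H) (A.op a)] at h1
      exact Complex.conj_eq_iff_im.1 h1.symm
    rw [@norm_sub_sq ℂ, norm_smul, inner_smul_right]
    simp [him]
  have hcl : IsClosed (A.op.graph : Set (H × H)) := hA.isClosed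
  have : CompleteSpace A.op.graph := hcl.completeSpace_coe
  let T : A.op.graph →L[ℂ] H :=
    (ContinuousLinearMap.snd ℂ H H - Complex.I • ContinuousLinearMap.fst ℂ H H).comp
      A.op.graph.subtypeL
  have hT : ∀ p : A.op.graph, T p = (p : H × H).2 - Complex.I • (p : H × H).1 := fun p => rfl
  have hbound : ∀ p : A.op.graph, ‖p‖ ≤ 1 * ‖T p‖ := by
    rintro ⟨⟨x, y⟩, hp⟩
    obtain ⟨a, rfl, rfl⟩ := (LinearPMap.mem_graph_iff A.op).1 hp
    have h1 := hnorm a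
    rw [hT, one_mul]
    change max ‖(a : H)‖ ‖A.op a‖ ≤ ‖A.op a - Complex.I • (a : H)‖
    refine max_le ?_ ?_
    · exact le_of_sq_le_sq (by nlinarith [sq_nonneg ‖A.op a‖]) (norm_nonneg _)
    · exact le_of_sq_le_sq (by nlinarith [sq_nonneg ‖(a : H)‖]) (norm_nonneg _)
  have hanti : AntilipschitzWith 1 T :=
    ContinuousLinearMap.antilipschitz_of_bound T (by simpa using hbound)
  have hrc : IsClosed (Set.range T) := hanti.isClosed_range T.uniformContinuous
  have hinj : Function.Injective T := hanti.injective
  have hsurj : Function.Surjective T := by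
    have hrange : T.range = ⊤ := by
      have : CompleteSpace T.range := by
        have : IsClosed (T.range : Set H) := hrc
        exact this.completeSpace_coe
      rw [← Submodule.orthogonal_eq_bot_iff, Submodule.eq_bot_iff]
      intro v hv
      have hv' : ∀ a : A.op.domain, ⟪A.op a - Complex.I • (a : H), v⟫_ℂ = 0 := fun a =>
        (Submodule.mem_orthogonal _ _).1 hv _ ⟨⟨_, A.op.mem_graph a⟩, rfl⟩
      have hvg : (v, -(Complex.I • v)) ∈ A.op.graph := by
        rw [hg]
        intro a
        have := hv' a
        rw [inner_sub_left, inner_smul_left] at this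
        rw [inner_neg_right, inner_smul_right]
        simp at this ⊢
        linear_combination this
      obtain ⟨a, ha, hb⟩ := (LinearPMap.mem_graph_iff A.op).1 hvg
      simp only at ha hb
      have h0 := hsym a a
      rw [hb, ha, inner_neg_left, inner_neg_right, inner_smul_left, inner_smul_right] at h0
      simp only [Complex.conj_I] at h0
      have h1 : Complex.I * ⟪v, v⟫_ℂ = 0 := by linear_combination h0 / 2
      exact inner_self_eq_zero.1 ((mul_eq_zero.1 h1).resolve_left Complex.I_ne_zero)
    exact LinearMap.range_eq_top.1 hrange
  let e : A.op.graph ≃L[ℂ] H := ContinuousLinearEquiv.ofBijective T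
    (LinearMap.ker_eq_bot.2 hinj) (LinearMap.range_eq_top.2 hsurj)
  have he : ∀ p, e p = T p := fun p => rfl
  refine ⟨(ContinuousLinearMap.fst ℂ H H).comp
    (A.op.graph.subtypeL.comp (e.symm : H →L[ℂ] A.op.graph)), fun y => ?_, fun x => ?_⟩
  · change ∃ h : ((e.symm y : A.op.graph) : H × H).1 ∈ A.op.domain,
      A.op ⟨((e.symm y : A.op.graph) : H × H).1, h⟩
        - Complex.I • ((e.symm y : A.op.graph) : H × H).1 = y
    have h1 : T (e.symm y) = y := by rw [← he, e.apply_symm_apply]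
    rw [hT] at h1
    obtain ⟨a, ha, hb⟩ := (LinearPMap.mem_graph_iff A.op).1 (e.symm y).2
    refine ⟨ha ▸ a.2, ?_⟩
    have : (⟨((e.symm y : A.op.graph) : H × H).1, ha ▸ a.2⟩ : A.op.domain) = a :=
      Subtype.ext ha.symm
    rw [this, hb]
    exact h1
  · change ((e.symm (A.op x - Complex.I • (x : H)) : A.op.graph) : H × H).1 = x
    have : A.op x - Complex.I • (x : H) = e ⟨_, A.op.mem_graph x⟩ := rfl
    rw [this, e.symm_apply_apply]

/-- The resolvent `(A - i)⁻¹` as a bounded operator. -/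
def SA.resolvent (A : SA H) : H →L[ℂ] H := A.exists_resolvent.choose

theorem SA.isResolventAt_resolvent (A : SA H) : IsResolventAt A.op Complex.I A.resolvent :=
  A.exists_resolvent.choose_spec

/-- The norm resolvent topology: the weakest topology on `SA(H)` for which `A ↦ (A - i)⁻¹` is
continuous into the bounded operators with the operator norm. -/
instance SA.normResolventTopology : TopologicalSpace (SA H) :=
  TopologicalSpace.induced SA.resolvent inferInstance

variable (H) in
/-- The set `EES(H)` of self-adjoint operators with empty essential spectrum. As a subtype it
carries the subspace topology of the norm resolvent topology. -/
def EES : Set (SA H) := {A | essSpectrum A.op = ∅}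

/-! ### The group `G = K(H)_sa ⋊ U(H)` and its action on `SA(H)` -/

variable (H) in
/-- The additive group `K(H)_sa` of compact self-adjoint operators, with the norm topology
inherited from `H →L[ℂ] H`. -/
def CompactSA : AddSubgroup (H →L[ℂ] H) where
  carrier := {K | IsCompactOperator K ∧ IsSelfAdjoint K}
  zero_mem' := ⟨isCompactOperator_zero, IsSelfAdjoint.zero _⟩
  add_mem' hK hL := ⟨hK.1.add hL.1, hK.2.add hL.2⟩
  neg_mem' hK := ⟨hK.1.neg, hK.2.neg⟩

theorem U.conjCLM_mem (u : U H) {K : H →L[ℂ] H} (hK : K ∈ CompactSA H) :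
    u.conjCLM K ∈ CompactSA H := by
  refine ⟨(hK.1.comp_clm (u⁻¹).toCLM).clm_comp u.toCLM, ?_⟩
  have hK2 := ContinuousLinearMap.isSelfAdjoint_iff_isSymmetric.1 hK.2
  rw [ContinuousLinearMap.isSelfAdjoint_iff_isSymmetric]
  intro x y
  change ⟪u (K (u⁻¹ x)), y⟫_ℂ = ⟪x, u (K (u⁻¹ y))⟫_ℂ
  rw [u.inner_apply_left, ← u.inner_inv_apply_left]
  exact hK2 _ _

variable (H) in
/-- The action of `U(H)` on `K(H)_sa` by conjugation, `u · K = u K u*`. -/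
def conjAction : U H →* MulAut (Multiplicative (CompactSA H)) where
  toFun u :=
    { toFun := fun K => Multiplicative.ofAdd ⟨u.conjCLM K.toAdd, u.conjCLM_mem K.toAdd.2⟩
      invFun := fun K => Multiplicative.ofAdd ⟨u⁻¹.conjCLM K.toAdd, u⁻¹.conjCLM_mem K.toAdd.2⟩
      left_inv := fun K => by
        apply Multiplicative.toAdd.injective
        ext x
        change u⁻¹ (u (K.toAdd.1 (u⁻¹ (u⁻¹⁻¹ x)))) = K.toAdd.1 x
        rw [u.inv_apply, inv_inv, u.inv_apply]
      right_inv := fun K => by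
        apply Multiplicative.toAdd.injective
        ext x
        change u (u⁻¹ (K.toAdd.1 (u⁻¹⁻¹ (u⁻¹ x)))) = K.toAdd.1 x
        rw [u.apply_inv, inv_inv, u.apply_inv]
      map_mul' := fun K L => by
        apply Multiplicative.toAdd.injective
        ext x
        exact map_add u.toCLM (K.toAdd.1 (u⁻¹ x)) (L.toAdd.1 (u⁻¹ x)) }
  map_one' := rfl
  map_mul' u v := by
    refine MulEquiv.ext fun K => Multiplicative.toAdd.injective (Subtype.ext ?_)
    ext x
    change (u * v) (K.toAdd.1 ((u * v)⁻¹ x)) = u (v (K.toAdd.1 (v⁻¹ (u⁻¹ x))))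
    rw [mul_inv_rev]
    rfl

variable (H) in
/-- The group `G = K(H)_sa ⋊ U(H)`, with multiplication
`(K₁, u₁) (K₂, u₂) = (K₁ + u₁ K₂ u₁*, u₁ u₂)`. -/
def G : Type _ := Multiplicative (CompactSA H) ⋊[conjAction H] U H

instance : Group (G H) :=
  inferInstanceAs (Group (Multiplicative (CompactSA H) ⋊[conjAction H] U H))

/-- The component of `g ∈ G` in `K(H)_sa`. -/
def G.compactPart (g : G H) : CompactSA H := (SemidirectProduct.left g).toAdd

/-- The component of `g ∈ G` in `U(H)`. -/
def G.unitaryPart (g : G H) : U H := SemidirectProduct.right g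

/-- The product topology on `G = K(H)_sa ⋊ U(H)`. -/
instance : TopologicalSpace (G H) :=
  TopologicalSpace.induced (fun g : G H => (g.compactPart, g.unitaryPart)) inferInstance

/-! ### The action of `G` on `SA(H)` -/

/-- The operator `u A u*` with domain `{x : u* x ∈ dom A} = u (dom A)`. -/
def U.conj (u : U H) (A : H →ₗ.[ℂ] H) : H →ₗ.[ℂ] H where
  domain := A.domain.comap (u⁻¹.toCLM : H →ₗ[ℂ] H)
  toFun := (u.toCLM : H →ₗ[ℂ] H) ∘ₗ A.toFun ∘ₗ
    ((u⁻¹.toCLM : H →ₗ[ℂ] H).restrict fun _ hx => hx)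

/-- The operator `u A u* + K` with domain `u (dom A)`, for `g = (K, u)`. -/
def G.act (g : G H) (A : H →ₗ.[ℂ] H) : H →ₗ.[ℂ] H :=
  ((g.compactPart : H →L[ℂ] H) : H →ₗ[ℂ] H) +ᵥ g.unitaryPart.conj A

theorem G.mem_act_domain {g : G H} {A : H →ₗ.[ℂ] H} {x : H} :
    x ∈ (g.act A).domain ↔ g.unitaryPart⁻¹ x ∈ A.domain := Iff.rfl

theorem G.act_apply (g : G H) (A : H →ₗ.[ℂ] H) (x : (g.act A).domain) :
    g.act A x = (g.compactPart : H →L[ℂ] H) x + g.unitaryPart (A ⟨g.unitaryPart⁻¹ x, x.2⟩) := rfl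

theorem G.isSelfAdjoint_act (g : G H) {A : H →ₗ.[ℂ] H} (hA : IsSelfAdjoint A) :
    IsSelfAdjoint (g.act A) := by
  rw [isSelfAdjoint_iff_graph] at hA ⊢
  obtain ⟨hd, hg⟩ := hA
  have hK := ContinuousLinearMap.isSelfAdjoint_iff_isSymmetric.1 g.compactPart.2.2
  set u := g.unitaryPart with hu
  set K : H →L[ℂ] H := (g.compactPart : H →L[ℂ] H) with hKdef
  have hgraph : ∀ x y : H, (x, y) ∈ (g.act A).graph ↔ (u⁻¹ x, u⁻¹ (y - K x)) ∈ A.graph := by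
    intro x y
    simp only [LinearPMap.mem_graph_iff]
    constructor
    · rintro ⟨a, rfl, rfl⟩
      refine ⟨⟨u⁻¹ a, a.2⟩, rfl, ?_⟩
      simp only [G.act_apply, ← hu, ← hKdef, add_sub_cancel_left, u.inv_apply]
    · rintro ⟨a, ha, hb⟩
      have hx : u⁻¹ x ∈ A.domain := ha ▸ a.2
      refine ⟨⟨x, hx⟩, rfl, ?_⟩
      have : (⟨u⁻¹ x, hx⟩ : A.domain) = a := Subtype.ext ha.symm
      simp only [G.act_apply, ← hu, ← hKdef]
      rw [this, hb, u.apply_inv, add_sub_cancel]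
  refine ⟨?_, fun x y => ?_⟩
  · have h1 : ((g.act A).domain : Set H) = u.toCLM '' (A.domain : Set H) := by
      ext x
      constructor
      · intro hx
        exact ⟨u⁻¹ x, hx, u.apply_inv x⟩
      · rintro ⟨y, hy, rfl⟩
        change u⁻¹ (u y) ∈ A.domain
        rwa [u.inv_apply]
    rw [h1]
    exact (Function.Surjective.denseRange fun x => ⟨u⁻¹ x, u.apply_inv x⟩).dense_image
      u.toCLM.continuous hd
  · rw [hgraph, hg]
    constructor
    · intro h a
      have h1 := h ⟨u⁻¹ a, a.2⟩
      have h2 : ⟪K a, x⟫_ℂ = ⟪(a : H), K x⟫_ℂ := hK _ _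
      change ⟪K a + u (A ⟨u⁻¹ a, a.2⟩), x⟫_ℂ = _
      rw [inner_add_left, u.inner_apply_left, h1, h2]
      change _ + ⟪u⁻¹ (a : H), _⟫_ℂ = _
      rw [u.inner_inv_apply_left, u.apply_inv, inner_sub_right]
      ring
    · intro h a
      have ha : u⁻¹ (u a) ∈ A.domain := by rw [u.inv_apply]; exact a.2
      have h1 : ⟪K (u a) + u (A ⟨u⁻¹ (u a), ha⟩), x⟫_ℂ = ⟪u a, y⟫_ℂ := h ⟨u a, ha⟩
      have h2 : ⟪K (u a), x⟫_ℂ = ⟪u a, K x⟫_ℂ := hK _ _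
      have h3 : (⟨u⁻¹ (u a), ha⟩ : A.domain) = a := Subtype.ext (u.inv_apply _)
      rw [h3, inner_add_left, u.inner_apply_left, h2] at h1
      rw [← u.inner_apply_left (a : H), inner_sub_right, ← h1]
      ring

/-- The action of `G` on `SA(H)`: `(K, u) · A = u A u* + K`. -/
instance : MulAction (G H) (SA H) where
  smul g A := ⟨g.act A.op, g.isSelfAdjoint_act A.isSelfAdjoint⟩
  one_smul A := by
    apply SA.ext
    change (1 : G H).act A.op = A.op
    refine LinearPMap.ext rfl fun x hx hx' => ?_
    change (0 : H) + A.op ⟨x, _⟩ = _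
    rw [zero_add]
  mul_smul g h A := by
    apply SA.ext
    change (g * h).act A.op = g.act (h.act A.op)
    have hinv : ∀ x : H, (g * h).unitaryPart⁻¹ x = h.unitaryPart⁻¹ (g.unitaryPart⁻¹ x) := by
      intro x
      change (g.unitaryPart * h.unitaryPart)⁻¹ x = _
      rw [mul_inv_rev]
      rfl
    refine LinearPMap.ext ?_ fun x hx hx' => ?_
    · ext x
      rw [G.mem_act_domain, hinv]
      rfl
    · simp only [G.act_apply]
      change ((g.compactPart : H →L[ℂ] H) x +
        g.unitaryPart ((h.compactPart : H →L[ℂ] H) (g.unitaryPart⁻¹ x))) +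
        g.unitaryPart (h.unitaryPart (A.op ⟨(g * h).unitaryPart⁻¹ x, _⟩)) =
        (g.compactPart : H →L[ℂ] H) x + g.unitaryPart.toCLM
          ((h.compactPart : H →L[ℂ] H) (g.unitaryPart⁻¹ x) + h.unitaryPart
            (A.op ⟨h.unitaryPart⁻¹ (g.unitaryPart⁻¹ x), _⟩))
      rw [map_add, add_assoc]
      rfl

theorem G.smul_op (g : G H) (A : SA H) : (g • A).op = g.act A.op := rfl

end EESPolish

end

/-! Everything is transported to the bounded operator `R = (A - i)⁻¹`, which determines `A` and by
definition induces the topology. The resolvents of self-adjoint operators are exactly the `R` of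
dense range with `R - R* = 2i R* R = 2i R R*` (`SA.isCayley_resolvent`,
`IsCayley.exists_resolvent_eq`).

The essential spectrum is empty iff `R` is compact (`SA.mem_EES_iff`): `w ↦ i + w⁻¹` carries the
nonzero spectrum and eigenspaces of `R` to those of `A`, and a normal operator is compact iff its
nonzero spectral values are isolated eigenvalues of finite multiplicity. Hence `EES H` is
homeomorphic to a set of compact operators cut out by closed identities and by density of the range,
a countable intersection of open conditions. Compact operators form a closed separable set, so `EES
H` is Polish.

For `G` and its action the key is `U.continuousAt_conjCLM`: `(u, K) ↦ u K u*` is norm continuous at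
compact `K`, although `u` varies only strongly. This makes `G` a topological group. It also gives
continuity of the action, since `u A u* + K` has resolvent `Q (1 + K Q)⁻¹` with `Q = u R u*` compact
(`SA.resolvent_smul`). Finally, evaluation at a Hilbert basis shows that `U H` is Polish. -/

noncomputable section

open Filter Topology TopologicalSpace

/-! ### Polish subspaces and orthonormal families -/

/-- A space embedded in a Polish space with a `Gδ` range is Polish. -/
theorem Topology.IsEmbedding.polishSpace_of_range_eq_iInter {α β ι : Type*} [TopologicalSpace α]
    [TopologicalSpace β] [PolishSpace β] [Countable ι] [Nonempty ι] {f : α → β}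
    (hf : IsEmbedding f) {V : ι → Set β} (hV : ∀ i, IsOpen (V i))
    (hr : Set.range f = ⋂ i, V i) : PolishSpace α := by
  have hP : ∀ i, PolishSpace (V i) := fun i => (hV i).polishSpace
  have hmem : ∀ a i, f a ∈ V i := fun a => Set.mem_iInter.1 (hr ▸ Set.mem_range_self a)
  -- The intersection sits in the Polish product of the open sets `V i` as its diagonal, which is
  -- closed.
  let F : α → ∀ i, V i := fun a i => ⟨f a, hmem a i⟩
  have hFc : Continuous F := continuous_pi fun i => hf.continuous.subtype_mk _
  let i₀ : ι := Classical.arbitrary ι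
  have hcomp : (fun g : ∀ i, V i => (g i₀ : β)) ∘ F = f := rfl
  have hpr : Continuous fun g : ∀ i, V i => (g i₀ : β) :=
    continuous_subtype_val.comp (continuous_apply i₀)
  have hemb : IsEmbedding F := IsEmbedding.of_comp hFc hpr (hcomp ▸ hf)
  have hran : Set.range F = {g | ∀ i j, (g i : β) = g j} := by
    ext g
    constructor
    · rintro ⟨a, rfl⟩ i j
      rfl
    · intro hg
      have hm : (g i₀ : β) ∈ Set.range f := by
        rw [hr, Set.mem_iInter]
        intro i
        rw [hg i₀ i]
        exact (g i).2
      obtain ⟨a, ha⟩ := hm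
      exact ⟨a, funext fun i => Subtype.ext (ha.trans (hg i₀ i))⟩
  have hcl : IsClosed (Set.range F) := by
    rw [hran]
    simp only [Set.ofPred_forall]
    exact isClosed_iInter fun i => isClosed_iInter fun j => isClosed_eq
      (continuous_subtype_val.comp (continuous_apply i))
      (continuous_subtype_val.comp (continuous_apply j))
  exact (IsClosedEmbedding.mk hemb hcl).polishSpace

/-- An orthonormal family in a separable space is countable. -/
theorem Orthonormal.countable {𝕜 E ι : Type*} [RCLike 𝕜] [NormedAddCommGroup E]
    [InnerProductSpace 𝕜 E] [SeparableSpace E] {v : ι → E} (hv : Orthonormal 𝕜 v) :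
    Countable ι := by
  -- Distinct orthonormal vectors are at distance `√2 > 1`, so balls of radius `1/2` about them are
  -- disjoint.
  have hd : Pairwise (Function.onFun Disjoint fun i => Metric.ball (v i) (1 / 2)) := by
    intro i j hij
    refine Metric.ball_disjoint_ball ?_
    have h1 : ‖v i - v j‖ ^ 2 = 2 := by
      rw [@norm_sub_sq 𝕜, hv.1, hv.1, hv.2 hij]
      norm_num
    rw [dist_eq_norm]
    nlinarith [norm_nonneg (v i - v j)]
  have hc := Set.PairwiseDisjoint.countable_of_isOpen (a := Set.univ)
    (fun i _ j _ hij => hd hij) (fun i _ => Metric.isOpen_ball)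
    (fun i _ => ⟨v i, Metric.mem_ball_self (by norm_num)⟩)
  exact Set.countable_univ_iff.1 hc

/-! ### Approximation and separability of compact operators -/

section CompactOperators

variable {H : Type*} [NormedAddCommGroup H] [InnerProductSpace ℂ H]

theorem isCompactOperator_of_finiteDimensional_range {K : H →L[ℂ] H} {E : Submodule ℂ H}
    [FiniteDimensional ℂ E] (hE : ∀ x, K x ∈ E) : IsCompactOperator K := by
  have : ProperSpace E := FiniteDimensional.proper ℂ E
  have := isCompactOperator_of_locallyCompactSpace_dom (K.codRestrict E hE)
  exact this.clm_comp E.subtypeL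

variable [CompleteSpace H]

/-- Compose `K` with the projection onto the span of a finite `ε/2`-net of the image of the unit
ball: being a best approximation, the projection moves each such `K x` by at most `ε/2`. -/
theorem IsCompactOperator.mem_closure_span_rankOne {K : H →L[ℂ] H} (hK : IsCompactOperator K) :
    K ∈ closure (Submodule.span ℂ
      (Set.range fun p : H × H => InnerProductSpace.rankOne ℂ p.1 p.2) : Set (H →L[ℂ] H)) := by
  rw [Metric.mem_closure_iff]
  intro ε hε
  obtain ⟨C, hC, hKC⟩ := hK.image_closedBall_subset_compact (1 : ℝ)
  obtain ⟨t, -, ht, hcov⟩ := hC.finite_cover_balls (half_pos hε)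
  let E : Submodule ℂ H := Submodule.span ℂ t
  have : FiniteDimensional ℂ E := FiniteDimensional.span_of_finite ℂ ht
  let b := stdOrthonormalBasis ℂ E
  refine ⟨E.starProjection * K, ?_, ?_⟩
  · rw [b.starProjection_eq_sum_rankOne, Finset.sum_mul]
    refine Submodule.sum_mem _ fun i _ => Submodule.subset_span
      ⟨((b i : H), ContinuousLinearMap.adjoint K (b i)), ?_⟩
    ext x
    simp [ContinuousLinearMap.adjoint_inner_left]
  · rw [dist_eq_norm]
    refine lt_of_le_of_lt (ContinuousLinearMap.opNorm_le_of_unit_norm (half_pos hε).le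
      fun x hx => ?_) (half_lt_self hε)
    have hx' : K x ∈ C := hKC ⟨x, by simp [hx], rfl⟩
    obtain ⟨y, hy, hxy⟩ := Set.mem_iUnion₂.1 (hcov hx')
    have hmin := E.starProjection_minimal (K x)
    change ‖K x - E.starProjection (K x)‖ ≤ ε / 2
    rw [hmin]
    refine (ciInf_le ⟨0, ?_⟩ (⟨y, Submodule.subset_span hy⟩ : E)).trans ?_
    · rintro _ ⟨z, rfl⟩
      exact norm_nonneg _
    · rw [Metric.mem_ball, dist_eq_norm] at hxy
      exact hxy.le

/-- Rank-one operators are a continuous image of the separable space `H × H`, and spans and closures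
of separable sets are separable. -/
theorem isSeparable_setOf_isCompactOperator [SeparableSpace H] :
    IsSeparable {K : H →L[ℂ] H | IsCompactOperator K} := by
  have h1 : Continuous fun p : H × H => InnerProductSpace.rankOne ℂ p.1 p.2 :=
    ((ContinuousLinearMap.smulRightL ℂ H H).continuous.comp
      ((innerSL ℂ).continuous.comp continuous_snd)).clm_apply continuous_fst
  exact ((isSeparable_range h1).span (R := ℂ)).closure.mono fun K hK =>
    IsCompactOperator.mem_closure_span_rankOne hK

/-- Having a compact adjoint is a closed linear condition, so it is enough to check rank-one
operators. -/
theorem IsCompactOperator.adjoint {K : H →L[ℂ] H} (hK : IsCompactOperator K) :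
    IsCompactOperator (ContinuousLinearMap.adjoint K) := by
  have hcl : IsClosed {K : H →L[ℂ] H | IsCompactOperator (ContinuousLinearMap.adjoint K)} :=
    isClosed_setOfPred_isCompactOperator.preimage
      (ContinuousLinearMap.adjoint (𝕜 := ℂ) (E := H) (F := H)).continuous
  refine closure_minimal (fun L hL => ?_) hcl hK.mem_closure_span_rankOne
  induction hL using Submodule.span_induction with
  | mem L hL =>
    obtain ⟨⟨a, b⟩, rfl⟩ := hL
    refine isCompactOperator_of_finiteDimensional_range (E := Submodule.span ℂ {b}) fun x => ?_
    simp only [InnerProductSpace.adjoint_rankOne, InnerProductSpace.rankOne_apply]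
    exact Submodule.smul_mem _ _ (Submodule.mem_span_singleton_self b)
  | zero =>
    change IsCompactOperator (ContinuousLinearMap.adjoint (0 : H →L[ℂ] H))
    rw [map_zero]
    exact isCompactOperator_zero
  | add L M _ _ hL hM =>
    change IsCompactOperator (ContinuousLinearMap.adjoint (L + M))
    rw [map_add]
    exact hL.add hM
  | smul c L _ hL =>
    change IsCompactOperator (ContinuousLinearMap.adjoint (c • L))
    rw [map_smulₛₗ]
    exact IsCompactOperator.smul hL _

end CompactOperators

/-! ### The unitary group in the strong operator topology -/

namespace EESPolish

variable {H : Type*} [NormedAddCommGroup H] [InnerProductSpace ℂ H]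

theorem U.continuous_apply (x : H) : Continuous fun u : U H => u x :=
  (_root_.continuous_apply x).comp continuous_induced_dom

theorem U.continuous_of_forall_apply {α : Type*} [TopologicalSpace α] {f : α → U H}
    (hf : ∀ x, Continuous fun a => f a x) : Continuous f :=
  continuous_induced_rng.2 (continuous_pi hf)

/-- Isometry gives both bounds: an error in the inner factor is not amplified by the outer one, and
`‖u⁻¹ x - u₀⁻¹ x‖ = ‖x - u (u₀⁻¹ x)‖`. -/
instance : IsTopologicalGroup (U H) where
  continuous_mul := by
    refine U.continuous_of_forall_apply fun x => continuous_iff_continuousAt.2 fun ⟨u₀, v₀⟩ => ?_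
    have h : Tendsto (fun p : U H × U H => ‖p.2 x - v₀ x‖ + ‖p.1 (v₀ x) - u₀ (v₀ x)‖)
        (𝓝 (u₀, v₀)) (𝓝 0) := by
      have h1 : Continuous fun p : U H × U H =>
          ‖p.2 x - v₀ x‖ + ‖p.1 (v₀ x) - u₀ (v₀ x)‖ :=
        (((U.continuous_apply x).comp continuous_snd).sub continuous_const).norm.add
          (((U.continuous_apply (v₀ x)).comp continuous_fst).sub continuous_const).norm
      simpa using h1.tendsto (u₀, v₀)
    refine tendsto_iff_norm_sub_tendsto_zero.2
      (squeeze_zero (fun _ => norm_nonneg _) (fun p => ?_) h)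
    change ‖p.1 (p.2 x) - u₀ (v₀ x)‖ ≤ _
    rw [← p.1.norm_map (p.2 x - v₀ x), map_sub]
    exact norm_sub_le_norm_sub_add_norm_sub _ _ _
  continuous_inv := by
    refine U.continuous_of_forall_apply fun x => continuous_iff_continuousAt.2 fun u₀ => ?_
    have h : Tendsto (fun u : U H => ‖x - u (u₀⁻¹ x)‖) (𝓝 u₀) (𝓝 0) := by
      have h1 : Continuous fun u : U H => ‖x - u (u₀⁻¹ x)‖ :=
        (continuous_const.sub (U.continuous_apply _)).norm
      simpa [U.apply_inv] using h1.tendsto u₀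
    refine tendsto_iff_norm_sub_tendsto_zero.2
      (squeeze_zero (fun _ => norm_nonneg _) (fun u => ?_) h)
    rw [← u.norm_map, map_sub, u.apply_inv]

theorem U.norm_toCLM_mul (u : U H) (K : H →L[ℂ] H) : ‖u.toCLM * K‖ = ‖K‖ := by
  refine ContinuousLinearMap.opNorm_ext _ _ fun x => ?_
  exact u.norm_map (K x)

theorem U.norm_toCLM_le (u : U H) : ‖u.toCLM‖ ≤ 1 := by
  refine ContinuousLinearMap.opNorm_le_bound _ zero_le_one fun x => ?_
  rw [one_mul]
  exact (u.norm_map x).le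

theorem U.norm_mul_toCLM_le (u : U H) (K : H →L[ℂ] H) : ‖K * u.toCLM‖ ≤ ‖K‖ :=
  (norm_mul_le _ _).trans (mul_le_of_le_one_right (norm_nonneg _) u.norm_toCLM_le)

/-- On a compact operator, left multiplication by unitaries turns strong convergence into norm
convergence. -/
theorem U.continuous_toCLM_mul {K : H →L[ℂ] H} (hK : IsCompactOperator K) :
    Continuous fun u : U H => u.toCLM * K := by
  refine continuous_iff_continuousAt.2 fun v => Metric.tendsto_nhds.2 fun ε hε => ?_
  obtain ⟨C, hC, hKC⟩ := hK.image_closedBall_subset_compact (1 : ℝ)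
  -- Unitaries are equicontinuous: closeness on a finite `ε/4`-net of the image of the unit ball
  -- gives closeness within `3ε/4` on that image, leaving room for a strict bound.
  have hε4 : 0 < ε / 4 := by positivity
  obtain ⟨t, -, ht, hcov⟩ := hC.finite_cover_balls hε4
  have hev : ∀ᶠ u : U H in 𝓝 v, ∀ y ∈ t, dist (u y) (v y) < ε / 4 :=
    (eventually_all_finite ht).2 fun y _ =>
      Metric.tendsto_nhds.1 (U.continuous_apply y).continuousAt _ hε4
  filter_upwards [hev] with u hu
  rw [dist_eq_norm]
  refine lt_of_le_of_lt (ContinuousLinearMap.opNorm_le_of_unit_norm (C := 3 * (ε / 4))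
    (by positivity) fun x hx => ?_) (by linarith)
  have hx' : K x ∈ C := hKC ⟨x, by simp [hx], rfl⟩
  obtain ⟨y, hy, hxy⟩ := Set.mem_iUnion₂.1 (hcov hx')
  change ‖u (K x) - v (K x)‖ ≤ _
  rw [← dist_eq_norm]
  have h1 := dist_triangle4 (u (K x)) (u y) (v y) (v (K x))
  rw [u.dist_map, v.dist_map, dist_comm y] at h1
  have h2 := hu y hy
  rw [Metric.mem_ball] at hxy
  linarith

variable [CompleteSpace H]

theorem U.adjoint_toCLM (u : U H) : ContinuousLinearMap.adjoint u.toCLM = (u⁻¹).toCLM := by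
  refine ((ContinuousLinearMap.eq_adjoint_iff _ _).2 fun x y => ?_).symm
  exact u.inner_inv_apply_left x y

/-- Taking adjoints turns this into left multiplication of the compact operator `K*`. -/
theorem U.continuous_mul_toCLM_inv {K : H →L[ℂ] H} (hK : IsCompactOperator K) :
    Continuous fun u : U H => K * (u⁻¹).toCLM := by
  have h : (fun u : U H => K * (u⁻¹).toCLM) = fun u : U H => star (u.toCLM * star K) := by
    funext u
    rw [star_mul, star_star, ContinuousLinearMap.star_eq_adjoint u.toCLM, u.adjoint_toCLM]
  rw [h]
  exact (U.continuous_toCLM_mul hK.adjoint).star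

/-- Conjugation is jointly continuous at compact operators. -/
theorem U.continuousAt_conjCLM (u₀ : U H) {K₀ : H →L[ℂ] H} (hK : IsCompactOperator K₀) :
    ContinuousAt (fun p : U H × (H →L[ℂ] H) => p.1.conjCLM p.2) (u₀, K₀) := by
  have h : Tendsto (fun p : U H × (H →L[ℂ] H) => ‖p.2 - K₀‖ +
      ‖p.1.toCLM * K₀ - u₀.toCLM * K₀‖ + ‖K₀ * (p.1⁻¹).toCLM - K₀ * (u₀⁻¹).toCLM‖)
      (𝓝 (u₀, K₀)) (𝓝 0) := by
    have h1 : Continuous (fun p : U H × (H →L[ℂ] H) => ‖p.2 - K₀‖ +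
      ‖p.1.toCLM * K₀ - u₀.toCLM * K₀‖ + ‖K₀ * (p.1⁻¹).toCLM - K₀ * (u₀⁻¹).toCLM‖) :=
      ((continuous_snd.sub continuous_const).norm.add
        (((U.continuous_toCLM_mul hK).comp continuous_fst).sub continuous_const).norm).add
        (((U.continuous_mul_toCLM_inv hK).comp continuous_fst).sub continuous_const).norm
    simpa using h1.tendsto (u₀, K₀)
  refine tendsto_iff_norm_sub_tendsto_zero.2
    (squeeze_zero (fun _ => norm_nonneg _) (fun p => ?_) h)
  obtain ⟨u, K⟩ := p
  -- The change of `u` is felt only against the fixed compact `K₀`, so `K` itself need not be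
  -- compact.
  have h2 : u.conjCLM K - u₀.conjCLM K₀ = u.toCLM * (K - K₀) * (u⁻¹).toCLM +
      (u.toCLM * K₀ - u₀.toCLM * K₀) * (u⁻¹).toCLM +
      u₀.toCLM * (K₀ * (u⁻¹).toCLM - K₀ * (u₀⁻¹).toCLM) := by
    rw [U.conjCLM, U.conjCLM]
    noncomm_ring
  rw [h2]
  refine (norm_add₃_le).trans (add_le_add (add_le_add ?_ ?_) ?_)
  · exact ((u⁻¹).norm_mul_toCLM_le _).trans (u.norm_toCLM_mul _).le
  · exact (u⁻¹).norm_mul_toCLM_le _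
  · exact (u₀.norm_toCLM_mul _).le

/-- The unitary group of a separable Hilbert space is Polish in the strong operator topology:
evaluation at a Hilbert basis identifies it with the `Gδ` set of Hilbert bases. -/
instance [SeparableSpace H] : PolishSpace (U H) := by
  obtain ⟨w, b, -⟩ := exists_hilbertBasis ℂ H
  have : Countable w := b.orthonormal.countable
  let S : Set (w → H) := {f | Orthonormal ℂ f}
  have hS : IsClosed S := by
    classical
    have : S = ⋂ i, ⋂ j, {f : w → H | ⟪f i, f j⟫_ℂ = if i = j then 1 else 0} := by
      ext f
      simp only [Set.mem_iInter]
      exact orthonormal_iff_ite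
    rw [this]
    exact isClosed_iInter fun i => isClosed_iInter fun j =>
      isClosed_eq ((_root_.continuous_apply i).inner (_root_.continuous_apply j)) continuous_const
  have : PolishSpace S := hS.polishSpace
  have hon : ∀ u : U H, Orthonormal ℂ fun i => u (b i) := fun u =>
    b.orthonormal.comp_linearIsometry u.toLinearIsometry
  let F : U H → S := fun u => ⟨fun i => u (b i), hon u⟩
  -- The span of `f` comes within `1/(m+1)` of the `n`-th vector of a dense sequence; all these
  -- conditions together say that the span is dense.
  let V : ℕ × ℕ → Set S := fun p =>
    {f | ∃ c : w →₀ ℂ, dist (Finsupp.linearCombination ℂ f.1 c) (denseSeq H p.1)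
      < 1 / ((p.2 : ℝ) + 1)}
  -- Pointwise convergence of isometries on the basis passes to its span by linearity and then to
  -- the closure by equicontinuity.
  have hcont : ∀ x : H, Continuous[induced F inferInstance, inferInstance] fun u : U H => u x := by
    let : TopologicalSpace (U H) := induced F inferInstance
    have hF : Continuous F := continuous_induced_dom
    have hb : ∀ i, Continuous fun u : U H => u (b i) := fun i =>
      (_root_.continuous_apply i).comp (continuous_subtype_val.comp hF)
    intro x
    have hx : x ∈ closure (Submodule.span ℂ (Set.range b) : Set H) := by
      rw [← Submodule.topologicalClosure_coe, b.dense_span]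
      trivial
    refine continuous_iff_continuousAt.2 fun u₀ => Metric.tendsto_nhds.2 fun ε hε => ?_
    have hε3 : 0 < ε / 3 := by positivity
    obtain ⟨y, hy, hxy⟩ := Metric.mem_closure_iff.1 hx _ hε3
    have hyc : Continuous fun u : U H => u y := by
      clear hxy
      induction hy using Submodule.span_induction with
      | mem y hy => obtain ⟨i, rfl⟩ := hy; exact hb i
      | zero => simp only [map_zero]; exact continuous_const
      | add y z _ _ hy hz => simp only [map_add]; exact hy.add hz
      | smul c y _ hy => simp only [map_smul]; exact hy.const_smul c
    filter_upwards [Metric.tendsto_nhds.1 (hyc.continuousAt (x := u₀)) _ hε3] with u hu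
    have h1 := dist_triangle4 (u x) (u y) (u₀ y) (u₀ x)
    rw [u.dist_map, u₀.dist_map, dist_comm y] at h1
    linarith
  have hind : IsInducing F := by
    refine ⟨le_antisymm ?_ ?_⟩
    · refine continuous_iff_le_induced.1 ?_
      exact (continuous_pi fun i => U.continuous_apply (b i)).subtype_mk _
    · exact continuous_iff_le_induced.1
        (@continuous_pi _ _ _ (induced F inferInstance) _ _ hcont)
  have hinj : Function.Injective F := by
    intro u v huv
    have h1 : Set.EqOn u v (Submodule.span ℂ (Set.range b) : Set H) := by
      have h2 : Set.EqOn (u.toCLM : H →ₗ[ℂ] H) (v.toCLM : H →ₗ[ℂ] H) (Set.range b) := by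
        rintro _ ⟨i, rfl⟩
        exact congrFun (congrArg Subtype.val huv) i
      exact LinearMap.eqOn_span h2
    have hd : Dense (Submodule.span ℂ (Set.range b) : Set H) := by
      intro x
      rw [← Submodule.topologicalClosure_coe, b.dense_span]
      trivial
    exact DFunLike.coe_injective (Continuous.ext_on hd u.continuous v.continuous h1)
  refine Topology.IsEmbedding.polishSpace_of_range_eq_iInter ⟨hind, hinj⟩ (V := V) ?_ ?_
  · intro p
    have : V p = ⋃ c : w →₀ ℂ, {f : S | dist (Finsupp.linearCombination ℂ f.1 c) (denseSeq H p.1)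
        < 1 / ((p.2 : ℝ) + 1)} := by
      ext f
      simp only [Set.mem_iUnion]
      rfl
    rw [this]
    refine isOpen_iUnion fun c => isOpen_lt (Continuous.dist ?_ continuous_const) continuous_const
    simp only [Finsupp.linearCombination_apply, Finsupp.sum]
    exact continuous_finsetSum _ fun i _ =>
      ((_root_.continuous_apply i).comp continuous_subtype_val).const_smul (c i)
  · ext f
    rw [Set.mem_iInter]
    constructor
    · rintro ⟨u, rfl⟩ p
      have hd : u⁻¹ (denseSeq H p.1) ∈ closure (Submodule.span ℂ (Set.range b) : Set H) := by
        rw [← Submodule.topologicalClosure_coe, b.dense_span]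
        trivial
      obtain ⟨y, hy, hxy⟩ := Metric.mem_closure_iff.1 hd (1 / ((p.2 : ℝ) + 1)) (by positivity)
      obtain ⟨c, rfl⟩ := (Finsupp.mem_span_range_iff_exists_finsupp).1 hy
      refine ⟨c, ?_⟩
      rw [← u.dist_map, u.apply_inv, dist_comm] at hxy
      convert hxy using 2
      simp only [Finsupp.linearCombination_apply, Finsupp.sum, map_sum, map_smul]
      rfl
    · intro hf
      have hsp : ⊤ ≤ (Submodule.span ℂ (Set.range f.1)).topologicalClosure := by
        intro x _
        refine Metric.mem_closure_iff.2 fun ε hε => ?_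
        obtain ⟨n, hn⟩ := (denseRange_denseSeq H).exists_dist_lt x (half_pos hε)
        obtain ⟨k, hk⟩ := exists_nat_one_div_lt (half_pos hε)
        obtain ⟨c, hc⟩ := hf (n, k)
        refine ⟨Finsupp.linearCombination ℂ f.1 c, ?_, ?_⟩
        · exact Finsupp.mem_span_range_iff_exists_finsupp.2 ⟨c, rfl⟩
        · have h1 := dist_triangle_right x (Finsupp.linearCombination ℂ f.1 c) (denseSeq H n)
          simp only at hc
          linarith
      -- An orthonormal family with dense span is a Hilbert basis, and the change of basis from `b`
      -- to it is the required unitary.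
      let b' : HilbertBasis w ℂ H := HilbertBasis.mk f.2 hsp
      refine ⟨b.repr.trans b'.repr.symm, Subtype.ext (funext fun i => ?_)⟩
      change b'.repr.symm (b.repr (b i)) = f.1 i
      classical
      rw [b.repr_self, b'.repr_symm_single]
      exact congrFun (HilbertBasis.coe_mk f.2 hsp) i

/-! ### The Polish group `G` -/

instance [SeparableSpace H] : PolishSpace (CompactSA H) := by
  have hcl : IsClosed (CompactSA H : Set (H →L[ℂ] H)) := by
    have h2 : IsClosed {K : H →L[ℂ] H | IsSelfAdjoint K} := isClosed_eq continuous_star continuous_id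
    exact isClosed_setOfPred_isCompactOperator.inter h2
  have : CompleteSpace (CompactSA H) := hcl.completeSpace_coe
  have : SeparableSpace (CompactSA H) :=
    (isSeparable_setOf_isCompactOperator.mono fun K (hK : K ∈ CompactSA H) =>
      hK.1).separableSpace
  infer_instance

theorem G.isInducing : IsInducing fun g : G H => (g.compactPart, g.unitaryPart) := ⟨rfl⟩

theorem G.continuous_compactPart : Continuous (G.compactPart (H := H)) :=
  continuous_fst.comp G.isInducing.continuous

theorem G.continuous_unitaryPart : Continuous (G.unitaryPart (H := H)) :=
  continuous_snd.comp G.isInducing.continuous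

theorem G.continuous_of_parts {α : Type*} [TopologicalSpace α] {f : α → G H}
    (h₁ : Continuous fun a => ((f a).compactPart : H →L[ℂ] H))
    (h₂ : Continuous fun a => (f a).unitaryPart) : Continuous f :=
  G.isInducing.continuous_iff.2 ((continuous_induced_rng.2 h₁).prodMk h₂)

theorem G.compactPart_mul (g h : G H) : ((g * h).compactPart : H →L[ℂ] H) =
    g.compactPart + g.unitaryPart.conjCLM h.compactPart := rfl

theorem G.compactPart_inv (g : G H) : ((g⁻¹).compactPart : H →L[ℂ] H) =
    g.unitaryPart⁻¹.conjCLM (-(g.compactPart : H →L[ℂ] H)) := rfl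

theorem continuous_conjCLM {α : Type*} [TopologicalSpace α] {f : α → U H} {k : α → H →L[ℂ] H}
    (hf : Continuous f) (hk : Continuous k) (hc : ∀ a, IsCompactOperator (k a)) :
    Continuous fun a => (f a).conjCLM (k a) :=
  continuous_iff_continuousAt.2 fun a =>
    ContinuousAt.comp (f := fun a => (f a, k a)) (U.continuousAt_conjCLM (f a) (hc a))
      (hf.prodMk hk).continuousAt

instance : IsTopologicalGroup (G H) where
  continuous_mul := by
    refine G.continuous_of_parts ?_ ?_
    · simp only [G.compactPart_mul]
      refine ((continuous_subtype_val.comp G.continuous_compactPart).comp continuous_fst).add ?_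
      exact continuous_conjCLM (G.continuous_unitaryPart.comp continuous_fst)
        ((continuous_subtype_val.comp G.continuous_compactPart).comp continuous_snd)
        fun p => p.2.compactPart.2.1
    · exact (G.continuous_unitaryPart.comp continuous_fst).mul
        (G.continuous_unitaryPart.comp continuous_snd)
  continuous_inv := by
    refine G.continuous_of_parts ?_ ?_
    · simp only [G.compactPart_inv]
      exact continuous_conjCLM G.continuous_unitaryPart.inv
        (continuous_subtype_val.comp G.continuous_compactPart).neg
        fun g => g.compactPart.2.1.neg
    · exact G.continuous_unitaryPart.inv

instance [SeparableSpace H] : PolishSpace (G H) := by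
  let e : G H ≃ CompactSA H × U H :=
    { toFun := fun g => (g.compactPart, g.unitaryPart)
      invFun := fun p => (⟨Multiplicative.ofAdd p.1, p.2⟩ :
        Multiplicative (CompactSA H) ⋊[conjAction H] U H)
      left_inv := fun _ => rfl
      right_inv := fun _ => rfl }
  exact e.polishSpace_induced

end EESPolish

/-! ### Resolvents of self-adjoint operators -/

namespace EESPolish

variable {H : Type*} [NormedAddCommGroup H] [InnerProductSpace ℂ H]

/-- The graph of `A` is thus read off from `R` alone, so one resolvent determines the operator. -/
theorem IsResolventAt.mem_graph_iff {A : H →ₗ.[ℂ] H} {z : ℂ} {R : H →L[ℂ] H}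
    (hR : IsResolventAt A z R) (x y : H) : (x, y) ∈ A.graph ↔ R (y - z • x) = x := by
  constructor
  · intro h
    obtain ⟨a, rfl, rfl⟩ := (LinearPMap.mem_graph_iff A).1 h
    exact hR.2 a
  · intro h
    obtain ⟨hd, he⟩ := hR.1 (y - z • x)
    refine (LinearPMap.mem_graph_iff A).2 ⟨⟨R (y - z • x), hd⟩, h, ?_⟩
    rw [sub_eq_iff_eq_add.1 he, h]
    exact sub_add_cancel _ _

theorem IsResolventAt.unique {A : H →ₗ.[ℂ] H} {z : ℂ} {R S : H →L[ℂ] H}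
    (hR : IsResolventAt A z R) (hS : IsResolventAt A z S) : R = S := by
  ext y
  obtain ⟨hd, he⟩ := hS.1 y
  have := hR.2 ⟨S y, hd⟩
  rwa [he] at this

variable [CompleteSpace H]

theorem SA.resolvent_eq {A : SA H} {R : H →L[ℂ] H} (hR : IsResolventAt A.op Complex.I R) :
    A.resolvent = R :=
  A.isResolventAt_resolvent.unique hR

theorem SA.resolvent_injective : Function.Injective (SA.resolvent (H := H)) := by
  intro A B hAB
  refine SA.ext (LinearPMap.eq_of_eq_graph ?_)
  ext ⟨x, y⟩
  rw [A.isResolventAt_resolvent.mem_graph_iff, B.isResolventAt_resolvent.mem_graph_iff, hAB]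

theorem SA.isInducing_resolvent : IsInducing (SA.resolvent (H := H)) := ⟨rfl⟩

/-- The identities `R - R* = 2i R* R = 2i R R*`, which together with the density of the range
characterize the resolvents at `i` of self-adjoint operators. -/
def IsCayley (R : H →L[ℂ] H) : Prop :=
  R - star R = (2 * Complex.I) • (star R * R) ∧ R - star R = (2 * Complex.I) • (R * star R)

theorem isClosed_setOf_isCayley : IsClosed {R : H →L[ℂ] H | IsCayley R} := by
  have h : Continuous fun R : H →L[ℂ] H => R - star R := continuous_id.sub continuous_star
  exact (isClosed_eq h ((continuous_star.mul continuous_id).const_smul (2 * Complex.I))).inter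
    (isClosed_eq h ((continuous_id.mul continuous_star).const_smul (2 * Complex.I)))

theorem IsCayley.isStarNormal {R : H →L[ℂ] H} (hR : IsCayley R) : IsStarNormal R := by
  have h := hR.1.symm.trans hR.2
  exact ⟨smul_right_injective (H →L[ℂ] H) (r := 2 * Complex.I) (by simp) h⟩

theorem SA.inner_apply_comm (A : SA H) (a b : A.op.domain) :
    ⟪A.op a, (b : H)⟫_ℂ = ⟪(a : H), A.op b⟫_ℂ :=
  (((isSelfAdjoint_iff_graph A.op).1 A.isSelfAdjoint).2 b (A.op b)).1 (A.op.mem_graph b) a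

/-- The first identity is the symmetry of `A` tested on `R x` and `R y`. The second needs full
self-adjointness, which puts `R* w` in the domain with `(A + i) R* w = w`. -/
theorem SA.isCayley_resolvent (A : SA H) : IsCayley A.resolvent := by
  have hR := A.isResolventAt_resolvent
  set R := A.resolvent
  have hg := ((isSelfAdjoint_iff_graph A.op).1 A.isSelfAdjoint).2
  constructor
  · ext y
    refine ext_inner_left ℂ fun x => ?_
    obtain ⟨hx, hx'⟩ := hR.1 x
    obtain ⟨hy, hy'⟩ := hR.1 y
    have h := A.inner_apply_comm ⟨R x, hx⟩ ⟨R y, hy⟩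
    rw [sub_eq_iff_eq_add.1 hx', sub_eq_iff_eq_add.1 hy'] at h
    simp only [inner_add_left, inner_add_right, inner_smul_left, inner_smul_right,
      Complex.conj_I] at h
    simp only [sub_apply, smul_apply,
      mul_apply_eq_comp, ContinuousLinearMap.star_eq_adjoint, inner_sub_right,
      inner_smul_right, ContinuousLinearMap.adjoint_inner_right]
    linear_combination h
  · ext w
    have h : (star R w, w - Complex.I • star R w) ∈ A.op.graph := by
      rw [hg]
      intro a
      have ha : R (A.op a - Complex.I • (a : H)) = a := hR.2 a
      rw [ContinuousLinearMap.star_eq_adjoint, inner_sub_right, inner_smul_right,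
        ContinuousLinearMap.adjoint_inner_right, ContinuousLinearMap.adjoint_inner_right]
      obtain ⟨b, hb⟩ : ∃ b, b = A.op a - Complex.I • (a : H) := ⟨_, rfl⟩
      rw [← hb] at ha
      rw [sub_eq_iff_eq_add.1 hb.symm, map_add, map_smul, ha, inner_add_left, inner_smul_left,
        Complex.conj_I]
      ring
    rw [hR.mem_graph_iff] at h
    have h2 : w - Complex.I • star R w - Complex.I • star R w = w - (2 * Complex.I) • star R w := by
      module
    rw [h2, map_sub, map_smul] at h
    simp only [sub_apply, smul_apply, mul_apply_eq_comp]
    nth_rewrite 1 [← h]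
    abel

theorem SA.denseRange_resolvent (A : SA H) : DenseRange A.resolvent := by
  have hd := ((isSelfAdjoint_iff_graph A.op).1 A.isSelfAdjoint).1
  refine hd.mono fun x hx => ?_
  exact ⟨_, A.isResolventAt_resolvent.2 ⟨x, hx⟩⟩

/-- The operator is `R⁻¹ + i`. If `R v = 0`, the first identity gives `R* v = 0`, so `v` is
orthogonal to the dense range and vanishes. The graph is `R (y - i x) = x`, the adjoint graph is `R*
(y + i x) = x`, and the two identities give one inclusion each. -/
theorem IsCayley.exists_resolvent_eq {R : H →L[ℂ] H} (hR : IsCayley R) (hd : DenseRange R) :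
    ∃ A : SA H, A.resolvent = R := by
  have hker : ∀ v, R v = 0 → v = 0 := by
    intro v hv
    have h1 := DFunLike.congr_fun hR.1 v
    simp only [sub_apply, smul_apply, mul_apply_eq_comp, hv, map_zero, smul_zero,
      zero_sub, neg_eq_zero] at h1
    have h2 : ∀ x, ⟪x, v⟫_ℂ = 0 := by
      have hc : Continuous fun x : H => ⟪x, v⟫_ℂ := continuous_id.inner continuous_const
      intro x
      refine congrFun (hd.equalizer hc (continuous_const (y := (0 : ℂ))) (funext fun y => ?_)) x
      change ⟪R y, v⟫_ℂ = 0
      rw [← ContinuousLinearMap.adjoint_inner_right, ← ContinuousLinearMap.star_eq_adjoint, h1,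
        inner_zero_right]
    exact inner_self_eq_zero.1 (h2 v)
  let T : H →ₗ[ℂ] H × H :=
    (R : H →ₗ[ℂ] H).prod (LinearMap.id + Complex.I • (R : H →ₗ[ℂ] H))
  have hT : ∀ v, T v = (R v, v + Complex.I • R v) := fun v => rfl
  let A : H →ₗ.[ℂ] H := (LinearMap.range T).toLinearPMap
  have hg0 : A.graph = LinearMap.range T := by
    refine Submodule.toLinearPMap_graph_eq _ ?_
    rintro _ ⟨v, rfl⟩ hv
    rw [hT] at hv ⊢
    simp only at hv
    simp [hker v hv]
  have hgr : ∀ x y, (x, y) ∈ A.graph ↔ R (y - Complex.I • x) = x := by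
    intro x y
    rw [hg0]
    constructor
    · rintro ⟨v, hv⟩
      rw [hT, Prod.mk.injEq] at hv
      rw [← hv.2, ← hv.1, add_sub_cancel_right]
    · intro h
      refine ⟨y - Complex.I • x, ?_⟩
      rw [hT, h, sub_add_cancel]
  have hmem : ∀ v, ∃ h : R v ∈ A.domain, A ⟨R v, h⟩ = v + Complex.I • R v := by
    intro v
    have h : (R v, v + Complex.I • R v) ∈ A.graph := by
      rw [hgr, add_sub_cancel_right]
    obtain ⟨a, ha, hb⟩ := (LinearPMap.mem_graph_iff A).1 h
    simp only at ha hb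
    refine ⟨ha ▸ a.2, ?_⟩
    rw [← hb]
    exact congrArg A.toFun (Subtype.ext ha.symm)
  have hsa : IsSelfAdjoint A := by
    rw [isSelfAdjoint_iff_graph]
    refine ⟨hd.mono ?_, fun x y => ?_⟩
    · rintro _ ⟨v, rfl⟩
      exact (hmem v).1
    · have h1 : (∀ a : A.domain, ⟪A a, x⟫_ℂ = ⟪(a : H), y⟫_ℂ) ↔
          star R (y + Complex.I • x) = x := by
        have h2 : ∀ v, ⟪v + Complex.I • R v, x⟫_ℂ - ⟪R v, y⟫_ℂ =
            ⟪v, x - star R (y + Complex.I • x)⟫_ℂ := by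
          intro v
          rw [ContinuousLinearMap.star_eq_adjoint, inner_sub_right,
            ContinuousLinearMap.adjoint_inner_right, inner_add_left, inner_add_right,
            inner_smul_left, inner_smul_right, Complex.conj_I]
          ring
        constructor
        · intro h
          refine (sub_eq_zero.1 (ext_inner_left ℂ fun v => ?_)).symm
          obtain ⟨hv, hv'⟩ := hmem v
          rw [← h2, ← hv', h ⟨R v, hv⟩, sub_self, inner_zero_right]
        · intro h a
          have ha := (hgr _ _).1 (A.mem_graph a)
          have h3 := h2 (A a - Complex.I • (a : H))
          rw [ha, h, sub_self, inner_zero_right, sub_add_cancel] at h3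
          exact sub_eq_zero.1 h3
      rw [h1, hgr]
      constructor
      · intro h
        have h3 := DFunLike.congr_fun hR.1 (y - Complex.I • x)
        simp only [sub_apply, smul_apply, mul_apply_eq_comp, h] at h3
        have h4 : y + Complex.I • x = (y - Complex.I • x) + (2 * Complex.I) • x := by module
        rw [h4, map_add, map_smul, ← h3]
        abel
      · intro h
        have h3 := DFunLike.congr_fun hR.2 (y + Complex.I • x)
        simp only [sub_apply, smul_apply, mul_apply_eq_comp, h] at h3
        have h4 : y - Complex.I • x = (y + Complex.I • x) - (2 * Complex.I) • x := by module
        rw [h4, map_sub, map_smul, ← h3]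
        abel
  refine ⟨⟨A, hsa⟩, SA.resolvent_eq ⟨fun v => ?_, fun x => (hgr _ _).1 (A.mem_graph x)⟩⟩
  obtain ⟨hv, hv'⟩ := hmem v
  refine ⟨hv, ?_⟩
  change A ⟨R v, hv⟩ - _ = _
  rw [hv', add_sub_cancel_right]

/-- `u A u* + K` has resolvent `Q (1 + K Q)⁻¹` with `Q = u (A - i)⁻¹ u*`. -/
theorem SA.resolvent_smul (g : G H) (A : SA H) :
    IsUnit (1 + (g.compactPart : H →L[ℂ] H) * g.unitaryPart.conjCLM A.resolvent) ∧
    (g • A).resolvent = g.unitaryPart.conjCLM A.resolvent *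
      Ring.inverse (1 + (g.compactPart : H →L[ℂ] H) * g.unitaryPart.conjCLM A.resolvent) := by
  have hR := A.isResolventAt_resolvent
  have hS := (g • A).isResolventAt_resolvent
  rw [G.smul_op] at hS
  set R := A.resolvent
  set S := (g • A).resolvent
  set u := g.unitaryPart with hu
  set K : H →L[ℂ] H := (g.compactPart : H →L[ℂ] H) with hK
  set Q := u.conjCLM R with hQdef
  have hQ : ∀ y, Q y = u (R (u⁻¹ y)) := fun _ => rfl
  -- This and `h2` are the two forms of the second resolvent identity; they make `1 - K * S` a
  -- two-sided inverse of `1 + K * Q` with no smallness condition on `K`.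
  have h1 : Q = S * (1 + K * Q) := by
    ext y
    obtain ⟨hd, he⟩ := hR.1 (u⁻¹ y)
    have hd' : Q y ∈ (g.act A.op).domain := by
      rw [G.mem_act_domain, hQ, ← hu, u.inv_apply]
      exact hd
    have h2 := hS.2 ⟨Q y, hd'⟩
    have h3 : g.act A.op ⟨Q y, hd'⟩ - Complex.I • Q y = y + K (Q y) := by
      rw [G.act_apply]
      have h4 : (⟨u⁻¹ (Q y), hd'⟩ : A.op.domain) = ⟨R (u⁻¹ y), hd⟩ :=
        Subtype.ext (u.inv_apply _)
      have h5 : A.op ⟨u⁻¹ (Q y), hd'⟩ = u⁻¹ y + Complex.I • R (u⁻¹ y) := by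
        rw [h4]
        exact sub_eq_iff_eq_add.1 he
      change K (Q y) + u (A.op ⟨u⁻¹ (Q y), hd'⟩) - _ = _
      rw [h5, map_add, map_smul, u.apply_inv, ← hQ]
      abel
    simp only at h2
    rw [h3] at h2
    exact h2.symm
  have h2 : S = Q * (1 - K * S) := by
    ext y
    obtain ⟨hd, he⟩ := hS.1 y
    rw [G.act_apply] at he
    change K (S y) + u (A.op ⟨u⁻¹ (S y), hd⟩) - Complex.I • S y = y at he
    have h3 := hR.2 ⟨u⁻¹ (S y), hd⟩
    have h4 : A.op ⟨u⁻¹ (S y), hd⟩ - Complex.I • u⁻¹ (S y) = u⁻¹ (y - K (S y)) := by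
      apply u.injective
      rw [map_sub, map_smul, u.apply_inv, u.apply_inv]
      linear_combination (norm := abel) he
    simp only at h3
    rw [h4] at h3
    change S y = Q (y - K (S y))
    rw [hQ, h3, u.apply_inv]
  have e1 : (1 + K * Q) * (1 - K * S) = 1 := by
    have : (1 + K * Q) * (1 - K * S) = 1 + K * (Q * (1 - K * S)) - K * S := by noncomm_ring
    rw [this, ← h2, add_sub_cancel_right]
  have e2 : (1 - K * S) * (1 + K * Q) = 1 := by
    have : (1 - K * S) * (1 + K * Q) = 1 + K * Q - K * (S * (1 + K * Q)) := by noncomm_ring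
    rw [this, ← h1, add_sub_cancel_right]
  let U' : (H →L[ℂ] H)ˣ := ⟨1 + K * Q, 1 - K * S, e1, e2⟩
  have h3 : Ring.inverse (1 + K * Q) = 1 - K * S := Ring.inverse_unit U'
  exact ⟨U'.isUnit, by rw [h3, ← h2]⟩

theorem SA.isCompactOperator_resolvent_smul (g : G H) {A : SA H}
    (hA : IsCompactOperator A.resolvent) : IsCompactOperator (g • A).resolvent := by
  rw [(A.resolvent_smul g).2]
  exact ((hA.comp_clm (g.unitaryPart⁻¹).toCLM).clm_comp g.unitaryPart.toCLM).comp_clm _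

/-- The action of `G` is jointly continuous at operators with compact resolvent. -/
theorem SA.continuousAt_smul (g : G H) {A : SA H} (hA : IsCompactOperator A.resolvent) :
    ContinuousAt (fun p : G H × SA H => p.1 • p.2) (g, A) := by
  rw [SA.isInducing_resolvent.continuousAt_iff]
  have hQ : ContinuousAt (fun p : G H × SA H => p.1.unitaryPart.conjCLM p.2.resolvent) (g, A) :=
    ContinuousAt.comp (x := (g, A)) (g := fun q : U H × (H →L[ℂ] H) => q.1.conjCLM q.2)
      (f := fun p : G H × SA H => (p.1.unitaryPart, p.2.resolvent))
      (U.continuousAt_conjCLM g.unitaryPart hA)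
      ((G.continuous_unitaryPart.comp continuous_fst).prodMk
        (SA.isInducing_resolvent.continuous.comp continuous_snd)).continuousAt
  have hK : Continuous fun p : G H × SA H => (p.1.compactPart : H →L[ℂ] H) :=
    (continuous_subtype_val.comp G.continuous_compactPart).comp continuous_fst
  have h1 : (SA.resolvent ∘ fun p : G H × SA H => p.1 • p.2) = fun p =>
      p.1.unitaryPart.conjCLM p.2.resolvent * Ring.inverse (1 + (p.1.compactPart : H →L[ℂ] H) *
        p.1.unitaryPart.conjCLM p.2.resolvent) :=
    funext fun p => (p.2.resolvent_smul p.1).2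
  rw [h1]
  -- Inversion is continuous at units, so invertibility at the base point is enough.
  obtain ⟨w, hw⟩ := (A.resolvent_smul g).1
  refine hQ.mul (ContinuousAt.comp (g := Ring.inverse) ?_
    (continuousAt_const.add (hK.continuousAt.mul hQ)))
  have h2 := NormedRing.inverse_continuousAt w
  rwa [hw] at h2

end EESPolish

/-! ### Empty essential spectrum and compact resolvents -/

/-- A compact operator has no infinite orthonormal family of eigenvectors whose eigenvalues are
bounded away from zero. -/
theorem IsCompactOperator.finite_of_orthonormal_of_apply_eq_smul {H ι : Type*}
    [NormedAddCommGroup H] [InnerProductSpace ℂ H] {R : H →L[ℂ] H} (hR : IsCompactOperator R)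
    {v : ι → H} (hv : Orthonormal ℂ v) {w : ι → ℂ} (hRv : ∀ i, R (v i) = w i • v i)
    {c : ℝ} (hc : 0 < c) (hw : ∀ i, c ≤ ‖w i‖) : Finite ι := by
  by_contra hfin
  rw [not_finite_iff_infinite] at hfin
  let e := Infinite.natEmbedding ι
  obtain ⟨K, hK, hRK⟩ := hR.image_closedBall_subset_compact (1 : ℝ)
  obtain ⟨y, -, ψ, hψ, hy⟩ := hK.tendsto_subseq
    (x := fun n => R (v (e n))) fun n => hRK ⟨v (e n), by simp [hv.1], rfl⟩
  have hC := Metric.cauchySeq_iff'.1 hy.cauchySeq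
  obtain ⟨N, hN⟩ := hC c hc
  have h1 := hN (N + 1) (Nat.le_succ N)
  have hne : e (ψ (N + 1)) ≠ e (ψ N) := fun h =>
    (hψ (Nat.lt_succ_self N)).ne' (e.injective h)
  rw [Function.comp_apply, Function.comp_apply, dist_eq_norm, hRv, hRv] at h1
  -- By Pythagoras the images stay at distance at least `c`, so no subsequence of them is Cauchy.
  have h2 : ‖w (e (ψ (N + 1))) • v (e (ψ (N + 1))) - w (e (ψ N)) • v (e (ψ N))‖ ^ 2 =
      ‖w (e (ψ (N + 1)))‖ ^ 2 + ‖w (e (ψ N))‖ ^ 2 := by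
    rw [@norm_sub_sq ℂ, inner_smul_left, inner_smul_right, hv.2 hne, norm_smul, norm_smul, hv.1,
      hv.1]
    simp
  have h3 := hw (e (ψ (N + 1)))
  have h4 := norm_nonneg (w (e (ψ (N + 1))) • v (e (ψ (N + 1))) - w (e (ψ N)) • v (e (ψ N)))
  nlinarith [sq_nonneg ‖w (e (ψ N))‖]

/-- A normal operator whose nonzero spectral values are isolated eigenvalues of finite
multiplicity is compact. -/
theorem IsStarNormal.isCompactOperator {H : Type*} [NormedAddCommGroup H]
    [InnerProductSpace ℂ H] [CompleteSpace H] {R : H →L[ℂ] H} (hR : IsStarNormal R)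
    (hacc : ∀ w ≠ 0, ¬ AccPt w (𝓟 (spectrum ℂ R)))
    (hfin : ∀ w ≠ 0, FiniteDimensional ℂ (Module.End.eigenspace (R : H →ₗ[ℂ] H) w)) :
    IsCompactOperator R := by
  classical
  -- `g μ` is `μ` times the indicator of `{μ}`, continuous on the spectrum because `μ ≠ 0` is not an
  -- accumulation point; `cfc (g μ) R` is `μ` times the spectral projection at `μ`.
  let g : ℂ → ℂ → ℂ := fun μ w => if w = μ then μ else 0
  have hg : ∀ μ ≠ 0, ContinuousOn (g μ) (spectrum ℂ R) := by
    intro μ hμ w _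
    by_cases hw : w = μ
    · subst hw
      have h1 : ∀ᶠ x in 𝓝[spectrum ℂ R] w, g w x = g w w := by
        have h2 := hacc w hμ
        rw [accPt_iff_frequently, not_frequently] at h2
        rw [eventually_nhdsWithin_iff]
        filter_upwards [h2] with x hx hxs
        by_cases hxw : x = w
        · rw [hxw]
        · exact absurd ⟨hxw, hxs⟩ hx
      exact tendsto_const_nhds.congr' (h1.mono fun x hx => hx.symm)
    · have h1 : ∀ᶠ x in 𝓝[spectrum ℂ R] w, g μ x = g μ w := by
        filter_upwards [nhdsWithin_le_nhds (isOpen_ne.mem_nhds hw)] with x hx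
        have hx' : x ≠ μ := hx
        simp [g, hx', hw]
      exact tendsto_const_nhds.congr' (h1.mono fun x hx => hx.symm)
  have hcomp : ∀ μ ≠ 0, IsCompactOperator (cfc (g μ) R : H →L[ℂ] H) := by
    intro μ hμ
    have := hfin μ hμ
    refine isCompactOperator_of_finiteDimensional_range
      (E := Module.End.eigenspace (R : H →ₗ[ℂ] H) μ) fun x => ?_
    -- From `w * g μ w = μ * g μ w`; it puts the range in the finite-dimensional `μ`-eigenspace.
    have h1 : R * cfc (g μ) R = μ • cfc (g μ) R := by
      rw [← cfc_const_mul μ (g μ) R (hg μ hμ)]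
      nth_rewrite 1 [← cfc_id' ℂ R]
      rw [← cfc_mul (fun x => x) (g μ) R continuousOn_id (hg μ hμ)]
      congr 1
      funext w
      by_cases hw : w = μ <;> simp [g, hw]
    rw [Module.End.mem_eigenspace_iff]
    exact DFunLike.congr_fun h1 x
  have hcl : R ∈ closure {K : H →L[ℂ] H | IsCompactOperator K} := by
    refine Metric.mem_closure_iff.2 fun ε hε => ?_
    have hε2 := half_pos hε
    -- The spectral values of modulus at least `ε/2` form a compact set without accumulation points,
    -- hence a finite one. Removing their parts from `R` leaves norm at most `ε/2`.
    let T : Set ℂ := spectrum ℂ R ∩ {w | ε / 2 ≤ ‖w‖}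
    have hTc : IsCompact T :=
      (spectrum.isCompact R).inter_right (isClosed_le continuous_const continuous_norm)
    have hT0 : ∀ w ∈ T, w ≠ 0 := by
      rintro w ⟨-, hw⟩ rfl
      have hw' : ε / 2 ≤ ‖(0 : ℂ)‖ := hw
      rw [norm_zero] at hw'
      linarith
    have hTf : T.Finite := by
      by_contra hinf
      obtain ⟨w, hw, hwa⟩ := Set.Infinite.exists_accPt_of_subset_isCompact hinf hTc subset_rfl
      exact hacc w (hT0 w hw) (hwa.mono (principal_mono.2 Set.inter_subset_left))
    have hgT : ∀ μ ∈ hTf.toFinset, ContinuousOn (g μ) (spectrum ℂ R) := fun μ hμ =>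
      hg μ (hT0 μ (hTf.mem_toFinset.1 hμ))
    refine ⟨∑ μ ∈ hTf.toFinset, cfc (g μ) R, ?_, ?_⟩
    · exact Submodule.sum_mem (compactOperator (RingHom.id ℂ) H H) fun μ hμ =>
        hcomp μ (hT0 μ (hTf.mem_toFinset.1 hμ))
    · have hsum : ContinuousOn (∑ μ ∈ hTf.toFinset, g μ) (spectrum ℂ R) := by
        have : (∑ μ ∈ hTf.toFinset, g μ) = fun x => ∑ μ ∈ hTf.toFinset, g μ x := by
          ext x
          simp
        rw [this]
        exact continuousOn_finsetSum _ hgT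
      rw [dist_eq_norm, ← cfc_sum g R _ hgT]
      nth_rewrite 1 [← cfc_id' ℂ R]
      rw [← cfc_sub (fun x => x) (∑ μ ∈ hTf.toFinset, g μ) R continuousOn_id hsum]
      refine lt_of_le_of_lt (norm_cfc_le hε2.le fun x hx => ?_) (half_lt_self hε)
      rw [Finset.sum_apply]
      simp only [g, Finset.sum_ite_eq, Set.Finite.mem_toFinset]
      by_cases hxT : x ∈ T
      · simp [hxT, hε2.le]
      · rw [if_neg hxT, sub_zero]
        exact (not_le.1 fun h => hxT ⟨hx, h⟩).le
  exact isClosed_setOfPred_isCompactOperator.closure_subset hcl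

namespace EESPolish

variable {H : Type*} [NormedAddCommGroup H] [InnerProductSpace ℂ H]

/-- The spectral mapping theorem for `(A - i)⁻¹`. -/
theorem IsResolventAt.mem_opSpectrum_iff {A : H →ₗ.[ℂ] H} {z₀ : ℂ} {R : H →L[ℂ] H}
    (hR : IsResolventAt A z₀ R) {w : ℂ} (hw : w ≠ 0) :
    z₀ + w⁻¹ ∈ opSpectrum A ↔ w ∈ spectrum ℂ R := by
  rw [← not_iff_not, opSpectrum, Set.mem_ofPred_eq, not_not, spectrum.notMem_iff,
    Algebra.algebraMap_eq_smul_one]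
  constructor
  · rintro ⟨Q, hQ⟩
    have h1 : ∀ y, Q y = R (y + w⁻¹ • Q y) := by
      intro y
      obtain ⟨hd, he⟩ := hQ.1 y
      have h2 := hR.2 ⟨Q y, hd⟩
      simp only at h2
      rw [sub_eq_iff_eq_add.1 he] at h2
      nth_rewrite 1 [← h2]
      congr 1
      module
    have h2 : ∀ y, R y = Q (y - w⁻¹ • R y) := by
      intro y
      obtain ⟨hd, he⟩ := hR.1 y
      have h2 := hQ.2 ⟨R y, hd⟩
      simp only at h2
      rw [sub_eq_iff_eq_add.1 he] at h2
      nth_rewrite 1 [← h2]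
      congr 1
      module
    -- Formally `w - R = w (A - z₀ - w⁻¹) R`, so the inverse is `w⁻¹ (A - z₀) Q = w⁻¹ (1 + w⁻¹ Q)`.
    -- The converse direction solves the same relation for `Q = w R (w - R)⁻¹`.
    let T : H →L[ℂ] H := w⁻¹ • (1 + w⁻¹ • Q)
    refine ⟨⟨w • 1 - R, T, ?_, ?_⟩, rfl⟩
    · ext y
      change w • (w⁻¹ • (y + w⁻¹ • Q y)) - R (w⁻¹ • (y + w⁻¹ • Q y)) = y
      rw [map_smul, ← h1, smul_inv_smul₀ hw, add_sub_cancel_right]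
    · ext y
      change w⁻¹ • ((w • y - R y) + w⁻¹ • Q (w • y - R y)) = y
      have h3 : w • y - R y = w • (y - w⁻¹ • R y) := by
        rw [smul_sub, smul_inv_smul₀ hw]
      rw [h3, map_smul, ← h2, inv_smul_smul₀ hw, smul_sub, smul_inv_smul₀ hw, sub_add_cancel,
        inv_smul_smul₀ hw]
  · rintro ⟨⟨V, S, h1, h2⟩, hV⟩
    simp only at hV
    subst hV
    have h1' : ∀ y, w • S y - R (S y) = y := fun y => DFunLike.congr_fun h1 y
    have h2' : ∀ y, S (w • y - R y) = y := fun y => DFunLike.congr_fun h2 y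
    refine ⟨w • (R * S), fun y => ?_, fun x => ?_⟩
    · obtain ⟨hd, he⟩ := hR.1 (w • S y)
      have h3 : (w • (R * S)) y = R (w • S y) := (map_smul R w (S y)).symm
      rw [h3]
      refine ⟨hd, ?_⟩
      rw [add_smul, ← sub_sub, he, map_smul, inv_smul_smul₀ hw, h1']
    · have h3 := hR.2 x
      change w • R (S (A x - (z₀ + w⁻¹) • (x : H))) = x
      rw [← map_smul, ← map_smul, add_smul, ← sub_sub, smul_sub, smul_inv_smul₀ hw]
      nth_rewrite 2 [← h3]
      rw [h2', h3]

theorem IsResolventAt.map_opEigenspace {A : H →ₗ.[ℂ] H} {z₀ : ℂ} {R : H →L[ℂ] H}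
    (hR : IsResolventAt A z₀ R) {w : ℂ} (hw : w ≠ 0) :
    (opEigenspace A (z₀ + w⁻¹)).map A.domain.subtype =
      Module.End.eigenspace (R : H →ₗ[ℂ] H) w := by
  ext x
  rw [Submodule.mem_map, Module.End.mem_eigenspace_iff]
  constructor
  · rintro ⟨a, ha, rfl⟩
    have ha' : A a - (z₀ + w⁻¹) • (a : H) = 0 := ha
    have h1 := hR.2 a
    have h2 : A a - z₀ • (a : H) = w⁻¹ • (a : H) := by
      rw [sub_eq_zero.1 ha']
      module
    rw [h2, map_smul] at h1
    change R a = w • (a : H)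
    nth_rewrite 2 [← h1]
    rw [smul_inv_smul₀ hw]
  · intro hx
    have hx' : R (w⁻¹ • x) = x := by
      rw [map_smul]
      rw [show R x = w • x from hx, inv_smul_smul₀ hw]
    obtain ⟨hd, he⟩ := hR.1 (w⁻¹ • x)
    refine ⟨⟨R (w⁻¹ • x), hd⟩, ?_, hx'⟩
    change A ⟨R (w⁻¹ • x), hd⟩ - (z₀ + w⁻¹) • R (w⁻¹ • x) = 0
    rw [add_smul, ← sub_sub, he, hx', sub_self]

theorem IsResolventAt.finiteDimensional_opEigenspace_iff {A : H →ₗ.[ℂ] H} {z₀ : ℂ}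
    {R : H →L[ℂ] H} (hR : IsResolventAt A z₀ R) {w : ℂ} (hw : w ≠ 0) :
    FiniteDimensional ℂ (opEigenspace A (z₀ + w⁻¹)) ↔
      FiniteDimensional ℂ (Module.End.eigenspace (R : H →ₗ[ℂ] H) w) := by
  rw [← hR.map_opEigenspace hw]
  exact Module.Finite.equiv_iff
    (Submodule.equivMapOfInjective _ A.domain.injective_subtype (opEigenspace A (z₀ + w⁻¹)))

variable [CompleteSpace H]

theorem SA.inner_eq_zero_of_apply_eq_smul (A : SA H) {a b : A.op.domain} {z z' : ℂ}
    (ha : A.op a = z • (a : H)) (hb : A.op b = z' • (b : H)) (ha0 : (a : H) ≠ 0) (hz : z ≠ z') :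
    ⟪(a : H), (b : H)⟫_ℂ = 0 := by
  have h1 := A.inner_apply_comm a a
  rw [ha, inner_smul_left, inner_smul_right] at h1
  have hreal := mul_right_cancel₀ (inner_self_ne_zero.2 ha0) h1
  have h2 := A.inner_apply_comm a b
  rw [ha, hb, inner_smul_left, inner_smul_right, hreal] at h2
  by_contra h
  exact hz (mul_right_cancel₀ h h2)

/-- The essential spectrum is empty exactly when the resolvent is compact. -/
theorem SA.mem_EES_iff (A : SA H) : A ∈ EES H ↔ IsCompactOperator A.resolvent := by
  have hR := A.isResolventAt_resolvent
  constructor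
  · intro hA
    have hess : ∀ z, z ∉ essSpectrum A.op := Set.eq_empty_iff_forall_notMem.1 hA
    have hnot : ∀ w ≠ 0, ¬ AccPt w (𝓟 (spectrum ℂ A.resolvent)) := by
      intro w hw hacc
      have hws : w ∈ spectrum ℂ A.resolvent := by
        refine (spectrum.isClosed A.resolvent).closure_subset ?_
        exact mem_closure_iff_clusterPt.2 hacc.clusterPt
      refine hess (Complex.I + w⁻¹) ⟨(hR.mem_opSpectrum_iff hw).2 hws, Or.inr ?_⟩
      rw [accPt_iff_frequently] at hacc ⊢
      have ht : Tendsto (fun x : ℂ => Complex.I + x⁻¹) (𝓝 w) (𝓝 (Complex.I + w⁻¹)) :=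
        tendsto_const_nhds.add (tendsto_inv₀ hw)
      refine ht.frequently ((hacc.and_eventually (isOpen_ne.mem_nhds hw)).mono ?_)
      rintro x ⟨⟨hxw, hxs⟩, hx0⟩
      exact ⟨fun h => hxw (inv_injective (add_left_cancel h)), (hR.mem_opSpectrum_iff hx0).2 hxs⟩
    refine A.isCayley_resolvent.isStarNormal.isCompactOperator hnot fun w hw => ?_
    rw [← hR.finiteDimensional_opEigenspace_iff hw]
    by_contra hinf
    refine hess (Complex.I + w⁻¹) ⟨(hR.mem_opSpectrum_iff hw).2 ?_, Or.inl hinf⟩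
    rw [hR.finiteDimensional_opEigenspace_iff hw] at hinf
    have h1 : Module.End.HasEigenvalue (A.resolvent : H →ₗ[ℂ] H) w := by
      intro hbot
      refine hinf ?_
      rw [show Module.End.eigenspace (A.resolvent : H →ₗ[ℂ] H) w = ⊥ from hbot]
      infer_instance
    rw [ContinuousLinearMap.spectrum_eq]
    exact h1.mem_spectrum
  · intro hc
    -- The point `i` is not in the spectrum, so every spectral point corresponds to a nonzero `w`,
    -- where the spectral theory of compact operators applies.
    have hsub : ∀ z ∈ opSpectrum A.op, ∃ w ≠ 0, z = Complex.I + w⁻¹ := by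
      intro z hz
      refine ⟨(z - Complex.I)⁻¹, inv_ne_zero (sub_ne_zero.2 ?_), by rw [inv_inv]; ring⟩
      rintro rfl
      exact hz ⟨_, hR⟩
    have heig : ∀ z ∈ opSpectrum A.op, ∃ a : A.op.domain, ‖(a : H)‖ = 1 ∧
        A.op a = z • (a : H) := by
      intro z hz
      obtain ⟨w, hw, rfl⟩ := hsub z hz
      have h1 := (hc.hasEigenvalue_iff_mem_spectrum hw).2 ((hR.mem_opSpectrum_iff hw).1 hz)
      obtain ⟨x, hx, hx0⟩ := h1.exists_hasEigenvector
      change x ∈ Module.End.eigenspace (A.resolvent : H →ₗ[ℂ] H) w at hx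
      rw [← hR.map_opEigenspace hw] at hx
      obtain ⟨a, ha, rfl⟩ := hx
      have ha' : A.op a - (Complex.I + w⁻¹) • (a : H) = 0 := ha
      have hn : ‖(a : H)‖ ≠ 0 := norm_ne_zero_iff.2 hx0
      refine ⟨((‖(a : H)‖⁻¹ : ℝ) : ℂ) • a, ?_, ?_⟩
      · rw [Submodule.coe_smul, norm_smul, Complex.norm_real, norm_inv, norm_norm,
          inv_mul_cancel₀ hn]
      · rw [LinearPMap.map_smul, sub_eq_zero.1 ha', Submodule.coe_smul, smul_comm]
    refine Set.eq_empty_iff_forall_notMem.2 ?_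
    rintro z ⟨hz, hinf | hacc⟩
    · obtain ⟨w, hw, rfl⟩ := hsub z hz
      rw [hR.finiteDimensional_opEigenspace_iff hw] at hinf
      exact hinf (ContinuousLinearMap.finite_dimensional_eigenspace hc w hw)
    -- Near an accumulation point `z` there would be infinitely many orthonormal eigenvectors of the
    -- resolvent, with eigenvalues `(x - i)⁻¹` of modulus at least `(‖z - i‖ + 1)⁻¹`.
    · choose! a hnorm ha using heig
      let Z : Set ℂ := Metric.ball z 1 ∩ opSpectrum A.op
      have hZ : Z.Infinite :=
        Set.Infinite.of_accPt (hacc.nhds_inter (Metric.ball_mem_nhds z one_pos))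
      have hon : Orthonormal ℂ fun x : Z => (a x : H) := by
        refine ⟨fun x => hnorm x x.2.2, fun x y hxy => ?_⟩
        refine A.inner_eq_zero_of_apply_eq_smul (ha x x.2.2) (ha y y.2.2) ?_
          fun h => hxy (Subtype.ext h)
        rw [← norm_ne_zero_iff, hnorm x x.2.2]
        exact one_ne_zero
      have hne : ∀ x : Z, (x : ℂ) - Complex.I ≠ 0 := by
        intro x h
        refine x.2.2 ⟨A.resolvent, ?_⟩
        rw [sub_eq_zero.1 h]
        exact hR
      have hRa : ∀ x : Z, A.resolvent (a x) = ((x : ℂ) - Complex.I)⁻¹ • (a x : H) := by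
        intro x
        have h1 := hR.2 (a x)
        rw [ha x x.2.2, ← sub_smul, map_smul] at h1
        rw [eq_inv_smul_iff₀ (hne x), h1]
      have hpos : 0 < ‖z - Complex.I‖ + 1 := by positivity
      refine hZ (Set.finite_coe_iff.1 (hc.finite_of_orthonormal_of_apply_eq_smul hon hRa
        (inv_pos.2 hpos) fun x => ?_))
      rw [norm_inv]
      refine inv_anti₀ (norm_pos_iff.2 (hne x)) ?_
      have h1 : ‖(x : ℂ) - z‖ < 1 := by
        rw [← dist_eq_norm]
        exact x.2.1
      have h2 := norm_sub_le_norm_sub_add_norm_sub (x : ℂ) z Complex.I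
      linarith

end EESPolish

/-! ### `EES(H)` as a Polish `G`-space -/

namespace EESPolish

variable {H : Type*} [NormedAddCommGroup H] [InnerProductSpace ℂ H] [CompleteSpace H]

theorem EES.smul_mem (g : G H) {A : SA H} (hA : A ∈ EES H) : g • A ∈ EES H :=
  (SA.mem_EES_iff _).2 (SA.isCompactOperator_resolvent_smul g ((SA.mem_EES_iff _).1 hA))

theorem EES.continuous_smul : Continuous fun p : G H × EES H =>
    (⟨p.1 • (p.2 : SA H), EES.smul_mem p.1 p.2.2⟩ : EES H) := by
  refine Continuous.subtype_mk (continuous_iff_continuousAt.2 fun p => ?_) _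
  exact ContinuousAt.comp (x := p) (g := fun q : G H × SA H => q.1 • q.2)
    (f := fun p : G H × EES H => (p.1, (p.2 : SA H)))
    (SA.continuousAt_smul p.1 ((SA.mem_EES_iff _).1 p.2.2))
    (continuous_fst.prodMk (continuous_subtype_val.comp continuous_snd)).continuousAt

/-- The resolvent identifies `EES(H)` with a `Gδ` set of compact operators. -/
instance [SeparableSpace H] : PolishSpace (EES H) := by
  let S : Set (H →L[ℂ] H) := {R | IsCompactOperator R ∧ IsCayley R}
  have hS : IsClosed S := isClosed_setOfPred_isCompactOperator.inter isClosed_setOf_isCayley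
  have : CompleteSpace S := hS.completeSpace_coe
  have : SeparableSpace S :=
    (isSeparable_setOf_isCompactOperator.mono fun R (hR : R ∈ S) => hR.1).separableSpace
  have : PolishSpace S := inferInstance
  let F : EES H → S := fun A =>
    ⟨(A : SA H).resolvent, (SA.mem_EES_iff _).1 A.2, SA.isCayley_resolvent _⟩
  have hF : IsEmbedding F := by
    have h1 : IsEmbedding fun A : EES H => (A : SA H).resolvent :=
      IsEmbedding.comp ⟨SA.isInducing_resolvent, SA.resolvent_injective⟩ IsEmbedding.subtypeVal
    exact IsEmbedding.of_comp (h1.continuous.subtype_mk _) continuous_subtype_val h1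
  -- The open conditions say that the range of `R` comes within `1/(m+1)` of each vector of a dense
  -- sequence; jointly they express density of the range.
  refine hF.polishSpace_of_range_eq_iInter (V := fun p : ℕ × ℕ =>
    {R : S | ∃ y, dist (R.1 y) (denseSeq H p.1) < 1 / ((p.2 : ℝ) + 1)}) (fun p => ?_) ?_
  · simp only [Set.ofPred_exists]
    refine isOpen_iUnion fun y => isOpen_lt (Continuous.dist ?_ continuous_const) continuous_const
    exact (ContinuousLinearMap.apply ℂ H y).continuous.comp continuous_subtype_val
  · ext R
    rw [Set.mem_iInter]
    constructor
    · rintro ⟨A, rfl⟩ p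
      obtain ⟨y, hy⟩ := (A : SA H).denseRange_resolvent.exists_dist_lt (denseSeq H p.1)
        (ε := 1 / ((p.2 : ℝ) + 1)) (by positivity)
      exact ⟨y, by rwa [dist_comm]⟩
    · intro hR
      have hd : DenseRange R.1 := by
        intro x
        refine Metric.mem_closure_iff.2 fun ε hε => ?_
        obtain ⟨n, hn⟩ := (denseRange_denseSeq H).exists_dist_lt x (half_pos hε)
        obtain ⟨k, hk⟩ := exists_nat_one_div_lt (half_pos hε)
        obtain ⟨y, hy⟩ := hR (n, k)
        refine ⟨R.1 y, ⟨y, rfl⟩, ?_⟩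
        have h1 := dist_triangle_right x (R.1 y) (denseSeq H n)
        simp only at hy
        linarith
      obtain ⟨A, hA⟩ := R.2.2.exists_resolvent_eq hd
      refine ⟨⟨A, (SA.mem_EES_iff A).2 ?_⟩, Subtype.ext hA⟩
      rw [hA]
      exact R.2.1

end EESPolish

end

theorem mainTheorem12 {H : Type*} [NormedAddCommGroup H] [InnerProductSpace ℂ H] [CompleteSpace H]
    [TopologicalSpace.SeparableSpace H] (hH : ¬ FiniteDimensional ℂ H) :
    PolishSpace (EESPolish.EES H) ∧
      (IsTopologicalGroup (EESPolish.G H) ∧ PolishSpace (EESPolish.G H)) ∧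
      ∃ hinv : ∀ (g : EESPolish.G H) (A : EESPolish.SA H),
          A ∈ EESPolish.EES H → g • A ∈ EESPolish.EES H,
        Continuous fun p : EESPolish.G H × EESPolish.EES H =>
          (⟨p.1 • (p.2 : EESPolish.SA H), hinv p.1 p.2 p.2.property⟩ : EESPolish.EES H) :=
  ⟨inferInstance, ⟨inferInstance, inferInstance⟩,
    fun g _ hA => EESPolish.EES.smul_mem g hA, EESPolish.EES.continuous_smul⟩
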